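/- **Theorem (consistency, dose--response setting).** Let $F$ be a probability distribution on $[0,1]^2$ with a Lebesgue density, let $\mu$ be a continuous function on $[0,1]^2$, let $\tau_0\in\mathbb R$ be known, and let $S_0\subset[0,1]^2$ be such that $\mu=\tau_0$ on $S_0$ and $\mu>\tau_0$ on $[0,1]^2\setminus S_0$. Let $X_1,X_2,\dots$ be i.i.d. with law $F$, let $(\epsilon_{ij})_{i,j\ge1}$ be i.i.d. with mean zero and finite variance and independent of $(X_i)_{i\ge1}$, and put $Y_{ij}=\mu(X_i)+\epsilon_{ij}$ and $\bar Y_{i\cdot}=m^{-1}\sum_{j=1}^mY_{ij}$. Let $\mathcal S$ be the class of closed convex subsets of $[0,1]^2$ (including $\emptyset$), let $\Phi$ be the standard normal distribution function, let $\gamma\in(1/2,1)$, and for $S\in\mathcal S$ let $$\mathbb M_{m,n}(S)=\frac1n\sum_{i=1}^n\Big\{\Phi\big(\sqrt m\,(\bar Y_{i\cdot}-\tau_0)\big)-\gamma\Big\}1_S(X_i),\qquad M(S)=\int_S\Big(\tfrac12 1_{S_0}(x)+1_{S_0^c}(x)-\gamma\Big)F(dx).$$ Let $\hat S_{m,n}$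 be any (not necessarily measurable) choice of a minimizer of $\mathbb M_{m,n}$ over $\mathcal S$. Assume that $S_0\in\mathcal S$, i.e. $S_0$ is closed and convex, and that $S_0$ is the unique minimizer of $M$ over $\mathcal S$. Then, as $\min(m,n)\to\infty$ (in particular for $m=m_n=m_0n^\beta$ with $m_0,\beta>0$ and $n\to\infty$), $$\sup_{S\in\mathcal S}|\mathbb M_{m,n}(S)-M(S)|\to0,\qquad d_F(\hat S_{m,n},S_0)=F(\hat S_{m,n}\,\triangle\,S_0)\to0,\qquad d_H(\hat S_{m,n},S_0)\to0$$ in outer probability, where $d_H$ is the Hausdorff distance for the $\ell_\infty$ metric on $\mathbb R^2$, with $d_H(\emptyset,S)=\infty$ for $S\neq\emptyset$. -/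

import Mathlib

open MeasureTheory ProbabilityTheory Filter Topology
open scoped NNReal ENNReal

noncomputable section

namespace DoseResponse

/-- The covariate plane. Its distance is the `ℓ_∞` distance and its `volume` is Lebesgue measure. -/
abbrev Plane : Type := Fin 2 → ℝ

/-- The covariate domain `[0,1]²`. -/
def unitSquare : Set Plane := Set.Icc 0 1

/-- The class of closed convex subsets of `[0,1]²` (the empty set included). -/
def closedConvexSets : Set (Set Plane) :=
  {S | IsClosed S ∧ Convex ℝ S ∧ S ⊆ unitSquare}

/-- The standard normal distribution function. -/
def stdNormalCDF (t : ℝ) : ℝ := cdf (gaussianReal 0 1) t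

/-- The average of the first `m` entries of a row of responses. -/
def rowMean (m : ℕ) (y : ℕ → ℝ) : ℝ := (∑ j ∈ Finset.range m, y j) / m

/-- The empirical criterion, with `n` covariate values `x i`, each having `m` responses `y i j`:
`(1/n) ∑_{i<n} {Φ(√m (ȳ_i - τ₀)) - γ} 1_S(x_i)`. -/
def empiricalCriterion (τ₀ γ : ℝ) (m n : ℕ) (x : ℕ → Plane) (y : ℕ → ℕ → ℝ)
    (S : Set Plane) : ℝ :=
  (∑ i ∈ Finset.range n,
    (stdNormalCDF (Real.sqrt m * (rowMean m (y i) - τ₀)) - γ) * S.indicator 1 (x i)) / n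

/-- The limiting criterion `∫_S {(1/2) 1_{S₀} + 1_{S₀ᶜ} - γ} dF`. -/
def limitCriterion (F : Measure Plane) (γ : ℝ) (S₀ S : Set Plane) : ℝ :=
  ∫ x in S, ((1 / 2) * S₀.indicator 1 x + S₀ᶜ.indicator 1 x - γ) ∂F

/-- `S₀` is the unique minimizer of `M` over the class `𝒮`. -/
def IsUniqueMinimizer (M : Set Plane → ℝ) (𝒮 : Set (Set Plane)) (S₀ : Set Plane) : Prop :=
  S₀ ∈ 𝒮 ∧ ∀ S ∈ 𝒮, S ≠ S₀ → M S₀ < M S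

/-- `S` is an element of the argmin of `M` over the class `𝒮`. -/
def IsMinimizer (M : Set Plane → ℝ) (𝒮 : Set (Set Plane)) (S : Set Plane) : Prop :=
  S ∈ 𝒮 ∧ ∀ T ∈ 𝒮, M S ≤ M T

/-- Convergence to zero in outer probability of `[0,∞]`-valued, possibly nonmeasurable, maps.
For an arbitrary set `A`, Mathlib's `P A` is the outer measure of `A`, the infimum of `P B` over
the measurable `B ⊇ A`. -/
def TendstoZeroInOuterProbability {Ω ι : Type*} [MeasurableSpace Ω] (P : Measure Ω)
    (l : Filter ι) (Z : ι → Ω → ℝ≥0∞) : Prop :=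
  ∀ δ : ℝ≥0, 0 < δ → Tendsto (fun k => P {ω | (δ : ℝ≥0∞) < Z k ω}) l (𝓝 0)

end DoseResponse

end

/-! This is an argmin argument: uniform convergence of the criterion together with a well-separated
minimizer of the limit.

Pointwise convergence: `√m (Ȳᵢ - τ₀)` is the drift `√m (μ(Xᵢ) - τ₀)` plus a normalized row sum of
errors, which is asymptotically a centred normal variable. On `S₀` the drift vanishes, and `Φ` has
mean `1/2` under any centred normal law by symmetry; off `S₀` the drift diverges and the mean of `Φ`
tends to `1` (`tendsto_integral_summand`). Chebyshev's inequality for averages of bounded variables,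
with a bound free of `m`, then gives convergence in probability for each fixed measurable set,
jointly in `m` and `n`.

Uniformity: a closed convex set Hausdorff-close to `K` differs from `K` only near the frontier of
`K`, which is Lebesgue null. With the Blaschke selection theorem this gives finitely many `L¹(F)`
brackets (`exists_finite_brackets`), and the criteria are controlled by their values and masses on
the brackets.

Separation: the limit criterion is continuous on the compact hyperspace of nonempty convex sets, so
a unique minimizer is well separated in Hausdorff distance
(`exists_hausdorffEDist_lt_of_limitCriterion_lt`). Near-optimality of the estimator thus gives
Hausdorff consistency, which in turn gives `d_F`-consistency. Only monotonicity and subadditivity of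
outer measure are applied to possibly nonmeasurable events. -/

namespace DoseResponse

/-! ### Convex sets that are close in Hausdorff distance -/

section Geometry

variable {E : Type*} [NormedAddCommGroup E] [NormedSpace ℝ E]

/-- A ball that meets both `K` and its complement meets the frontier of `K`. -/
theorem exists_mem_frontier_dist_lt {K : Set E} {x a b : E} {δ : ℝ} (ha : a ∈ K) (hb : b ∉ K)
    (hax : dist a x < δ) (hbx : dist b x < δ) : ∃ z ∈ frontier K, dist z x < δ := by
  by_contra! h
  have hc : IsPreconnected (Metric.ball x δ) := (convex_ball x δ).isPreconnected
  have hf : ∀ z ∈ Metric.ball x δ, z ∉ frontier K := fun z hz hzf => absurd hz (h z hzf).not_gt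
  have hsub : Metric.ball x δ ⊆ interior K := by
    refine hc.subset_left_of_subset_union isOpen_interior (isClosed_closure (s := K)).isOpen_compl
      ?_ ?_ ⟨a, hax, ?_⟩
    · exact Set.disjoint_left.2 fun z hz hz' => hz' (subset_closure (interior_subset hz))
    · intro z hz
      by_contra hz'
      simp only [Set.mem_union, Set.mem_compl_iff, not_or, not_not] at hz'
      exact hf z hz ⟨hz'.2, hz'.1⟩
    · by_contra ha'
      exact hf a hax ⟨subset_closure ha, ha'⟩
  exact hb (interior_subset (hsub hbx))

/-- If every point of a ball is closer than some `r < δ` to the closed convex set `S`, where `δ` is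
the radius of the ball, then the centre belongs to `S`. -/
theorem mem_of_forall_ball_dist_lt {S : Set E} (hSc : IsClosed S) (hS : Convex ℝ S)
    {x : E} {r δ : ℝ} (hr0 : 0 < r) (hr : r < δ)
    (h : ∀ y ∈ Metric.ball x δ, ∃ s ∈ S, dist y s < r) : x ∈ S := by
  by_contra hxS
  obtain ⟨f, u, hfS, hfx⟩ := geometric_hahn_banach_closed_point hS hSc hxS
  -- Moving from `x` by `r • v`, with `v` norming `f` up to `(f x - u) / r`, loses at most the
  -- separation gap. The new point then has `f`-value above `u + r * ‖f‖`, too large for a point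
  -- within `r` of `S`.
  have hη : 0 < (f x - u) / r := div_pos (sub_pos.2 hfx) hr0
  obtain ⟨v, hv1, hv⟩ : ∃ v : E, ‖v‖ < 1 ∧ ‖f‖ - (f x - u) / r < f v := by
    obtain ⟨v, hv1, hv⟩ := f.exists_lt_apply_of_lt_opNorm (sub_lt_self ‖f‖ hη)
    rcases abs_choice (f v) with h' | h'
    · exact ⟨v, hv1, by rwa [← h']⟩
    · exact ⟨-v, by rwa [norm_neg], by rwa [map_neg, ← h']⟩
  have hy : x + r • v ∈ Metric.ball x δ := by
    rw [Metric.mem_ball, dist_eq_norm, add_sub_cancel_left, norm_smul, Real.norm_of_nonneg hr0.le]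
    nlinarith
  obtain ⟨s, hs, hys⟩ := h _ hy
  have h1 : f (x + r • v) - f s ≤ ‖f‖ * r := by
    rw [← map_sub]
    refine (le_abs_self _).trans ((f.le_opNorm _).trans ?_)
    rw [← dist_eq_norm]
    gcongr
  have h2 := hfS s hs
  rw [map_add, map_smul, smul_eq_mul] at h1
  have h3 : r * (‖f‖ - (f x - u) / r) ≤ r * f v := by gcongr
  have h4 : r * (‖f‖ - (f x - u) / r) = r * ‖f‖ - (f x - u) := by field_simp
  linarith

/-- A set at Hausdorff distance less than `δ` from `K` lies within the union of `K` and the closed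
`δ`-thickening of its frontier. -/
theorem subset_union_cthickening_frontier {S K : Set E} {δ : ℝ}
    (h : Metric.hausdorffEDist S K < ENNReal.ofReal δ) :
    S ⊆ K ∪ Metric.cthickening δ (frontier K) := by
  intro x hx
  by_cases hxK : x ∈ K
  · exact Or.inl hxK
  obtain ⟨y, hy, hxy⟩ := Metric.exists_edist_lt_of_hausdorffEDist_lt hx h
  rw [edist_dist, ENNReal.ofReal_lt_ofReal_iff_of_nonneg dist_nonneg] at hxy
  obtain ⟨z, hz, hzx⟩ := exists_mem_frontier_dist_lt hy hxK ((dist_comm _ _).trans_lt hxy)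
    (by rw [dist_self]; exact dist_nonneg.trans_lt hxy)
  exact Or.inr (Metric.mem_cthickening_of_dist_le x z δ _ hz (by rw [dist_comm]; exact hzx.le))

/-- A closed convex set at Hausdorff distance less than `δ` from `K` contains the points of `K`
farther than `δ` from the frontier of `K`. -/
theorem diff_cthickening_frontier_subset {S K : Set E} (hSc : IsClosed S) (hS : Convex ℝ S)
    {δ : ℝ} (h : Metric.hausdorffEDist S K < ENNReal.ofReal δ) :
    K \ Metric.cthickening δ (frontier K) ⊆ S := by
  rintro x ⟨hxK, hxf⟩
  -- The ball of radius `δ` about `x` stays inside `K`, and all of `K` is within `r` of `S`; the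
  -- strict gap `r < δ` forces `x ∈ S`.
  obtain ⟨r, hr, hr'⟩ := exists_between h
  have hrt : r ≠ ∞ := (hr'.trans ENNReal.ofReal_lt_top).ne
  have hr0 : 0 < r.toReal := ENNReal.toReal_pos (bot_le.trans_lt hr).ne' hrt
  refine mem_of_forall_ball_dist_lt hSc hS hr0 ((ENNReal.lt_ofReal_iff_toReal_lt hrt).1 hr')
    fun y hy => ?_
  have hyK : y ∈ K := by
    by_contra hyK
    obtain ⟨z, hz, hzx⟩ := exists_mem_frontier_dist_lt hxK hyK
      (by rw [dist_self]; exact dist_nonneg.trans_lt hy) hy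
    exact hxf (Metric.mem_cthickening_of_dist_le x z δ _ hz (by rw [dist_comm]; exact hzx.le))
  rw [Metric.hausdorffEDist_comm] at hr
  obtain ⟨s, hs, hys⟩ := Metric.exists_edist_lt_of_hausdorffEDist_lt hyK hr
  refine ⟨s, hs, ?_⟩
  rwa [edist_dist, ENNReal.ofReal_lt_iff_lt_toReal dist_nonneg hrt] at hys

variable [MeasurableSpace E] [BorelSpace E] [FiniteDimensional ℝ E]

/-- Closed convex sets that are close to `K` in the Hausdorff distance lie between two measurable
sets whose difference has small measure. -/
theorem exists_bracket_of_hausdorffEDist_lt {ν : Measure E} [ν.IsAddHaarMeasure] {F : Measure E}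
    [IsFiniteMeasure F] (hF : F ≪ ν) {K : Set E} (hKc : IsClosed K) (hK : Convex ℝ K)
    {η : ℝ≥0∞} (hη : 0 < η) :
    ∃ δ : ℝ, 0 < δ ∧ ∃ l u : Set E, MeasurableSet l ∧ MeasurableSet u ∧ F (u \ l) < η ∧
      ∀ S : Set E, IsClosed S → Convex ℝ S → Metric.hausdorffEDist S K < ENNReal.ofReal δ →
        l ⊆ S ∧ S ⊆ u := by
  -- The bracket is `K` with a closed thickening of its frontier removed or added; the mass of the
  -- thickening shrinks to that of the frontier.
  have h0 : F (frontier K) = 0 := hF (hK.addHaar_frontier ν)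
  have ht := tendsto_measure_cthickening_of_isClosed (μ := F) (s := frontier K)
    ⟨1, one_pos, measure_ne_top _ _⟩ isClosed_frontier
  rw [h0] at ht
  have hev : ∀ᶠ δ in 𝓝[>] (0 : ℝ), F (Metric.cthickening δ (frontier K)) < η :=
    (ht.mono_left nhdsWithin_le_nhds).eventually (gt_mem_nhds hη)
  obtain ⟨δ, hδ, hδ0⟩ := (hev.and self_mem_nhdsWithin).exists
  refine ⟨δ, hδ0, K \ Metric.cthickening δ (frontier K), K ∪ Metric.cthickening δ (frontier K),
    hKc.measurableSet.diff Metric.isClosed_cthickening.measurableSet,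
    hKc.measurableSet.union Metric.isClosed_cthickening.measurableSet, ?_,
    fun S hSc hS h => ⟨diff_cthickening_frontier_subset hSc hS h,
      subset_union_cthickening_frontier h⟩⟩
  refine (measure_mono ?_).trans_lt hδ
  rintro x ⟨hx | hx, hx'⟩
  · by_contra h
    exact hx' ⟨hx, h⟩
  · exact hx

end Geometry
end DoseResponse

/-! ### Compactness of the hyperspace and finite bracketing -/

namespace DoseResponse

open TopologicalSpace Metric

/-- Convexity is preserved by limits in the Hausdorff distance. -/
theorem isClosed_setOf_convex {E : Type*} [NormedAddCommGroup E] [NormedSpace ℝ E] :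
    IsClosed {K : NonemptyCompacts E | Convex ℝ (K : Set E)} := by
  refine isClosed_of_closure_subset fun K hK x hx y hy a b ha hb hab => ?_
  rw [← K.isCompact.isClosed.closure_eq, Metric.mem_closure_iff]
  intro η hη
  obtain ⟨L, hL, hKL⟩ := Metric.mem_closure_iff.1 hK (η / 2) (half_pos hη)
  rw [← ENNReal.ofReal_lt_ofReal_iff (half_pos hη), ← edist_dist] at hKL
  have hKL' : hausdorffEDist (K : Set E) L < ENNReal.ofReal (η / 2) := hKL
  have key : ∀ z ∈ (K : Set E), ∃ z' ∈ (L : Set E), dist z z' < η / 2 := fun z hz => by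
    obtain ⟨z', hz', h⟩ := exists_edist_lt_of_hausdorffEDist_lt hz hKL'
    rw [edist_dist, ENNReal.ofReal_lt_ofReal_iff (half_pos hη)] at h
    exact ⟨z', hz', h⟩
  obtain ⟨x', hx', hxx'⟩ := key x hx
  obtain ⟨y', hy', hyy'⟩ := key y hy
  rw [hausdorffEDist_comm] at hKL'
  obtain ⟨z, hz, h⟩ := exists_edist_lt_of_hausdorffEDist_lt (hL hx' hy' ha hb hab) hKL'
  rw [edist_dist, ENNReal.ofReal_lt_ofReal_iff (half_pos hη)] at h
  refine ⟨z, hz, ?_⟩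
  have h1 : dist (a • x + b • y) (a • x' + b • y') ≤ η / 2 := by
    refine (dist_add_add_le _ _ _ _).trans ?_
    rw [dist_smul₀, dist_smul₀, Real.norm_of_nonneg ha, Real.norm_of_nonneg hb]
    have : η / 2 = a * (η / 2) + b * (η / 2) := by rw [← add_mul, hab, one_mul]
    rw [this]
    gcongr
  linarith [dist_triangle (a • x + b • y) (a • x' + b • y') z]

/-- The nonempty closed convex subsets of the unit square, as a set of compact sets. -/
def convexCompacts : Set (NonemptyCompacts Plane) := {K | (K : Set Plane) ∈ closedConvexSets}

/-- A form of the Blaschke selection theorem. -/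
theorem isCompact_convexCompacts : IsCompact convexCompacts := by
  have h : convexCompacts = {K : NonemptyCompacts Plane | (K : Set Plane) ⊆ unitSquare} ∩
      {K | Convex ℝ (K : Set Plane)} := by
    ext K
    exact ⟨fun h => ⟨h.2.2, h.2.1⟩, fun h => ⟨K.isCompact.isClosed, h.2, h.1⟩⟩
  rw [h]
  exact (NonemptyCompacts.isCompact_subsets_of_isCompact isCompact_Icc).inter_right
    isClosed_setOf_convex

theorem isCompact_of_mem_closedConvexSets {S : Set Plane} (hS : S ∈ closedConvexSets) :
    IsCompact S :=
  isCompact_Icc.of_isClosed_subset hS.1 hS.2.2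

/-- A nonempty closed convex subset of the unit square, as a nonempty compact set. -/
theorem exists_convexCompacts_coe_eq {S : Set Plane} (hS : S ∈ closedConvexSets)
    (hne : S.Nonempty) : ∃ K ∈ convexCompacts, (K : Set Plane) = S :=
  ⟨⟨⟨S, isCompact_of_mem_closedConvexSets hS⟩, hne⟩, hS, rfl⟩

theorem empty_mem_closedConvexSets : (∅ : Set Plane) ∈ closedConvexSets :=
  ⟨isClosed_empty, convex_empty, Set.empty_subset _⟩

variable {F : Measure Plane} [IsFiniteMeasure F]

/-- The closed convex subsets of the unit square have finite bracketing numbers in `L¹(F)`. -/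
theorem exists_finite_brackets (hF : F ≪ volume) {η : ℝ≥0∞} (hη : 0 < η) :
    ∃ B : Finset (Set Plane × Set Plane),
      (∀ p ∈ B, MeasurableSet p.1 ∧ MeasurableSet p.2 ∧ F (p.2 \ p.1) < η) ∧
      ∀ S ∈ closedConvexSets, ∃ p ∈ B, p.1 ⊆ S ∧ S ⊆ p.2 := by
  classical
  have key : ∀ K ∈ convexCompacts, ∃ δ : ℝ, 0 < δ ∧ ∃ p : Set Plane × Set Plane,
      (MeasurableSet p.1 ∧ MeasurableSet p.2 ∧ F (p.2 \ p.1) < η) ∧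
      ∀ S : Set Plane, IsClosed S → Convex ℝ S →
        hausdorffEDist S K < ENNReal.ofReal δ → p.1 ⊆ S ∧ S ⊆ p.2 := fun K hK => by
    obtain ⟨δ, hδ, l, u, hl, hu, hlu, h⟩ := exists_bracket_of_hausdorffEDist_lt hF hK.1 hK.2.1 hη
    exact ⟨δ, hδ, (l, u), ⟨hl, hu, hlu⟩, h⟩
  choose! δ hδ p hp h using key
  obtain ⟨t, ht, htc⟩ := isCompact_convexCompacts.elim_nhds_subcover
    (fun K => Metric.eball K (ENNReal.ofReal (δ K)))
    fun K hK => Metric.eball_mem_nhds K (ENNReal.ofReal_pos.2 (hδ K hK))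
  -- The empty set is not a point of `NonemptyCompacts`, so it gets its own bracket.
  refine ⟨insert (∅, ∅) (t.image p), ?_, fun S hS => ?_⟩
  · intro q hq
    rcases Finset.mem_insert.1 hq with rfl | hq
    · simpa using hη
    · obtain ⟨K, hK, rfl⟩ := Finset.mem_image.1 hq
      exact hp K (ht K hK)
  · rcases S.eq_empty_or_nonempty with rfl | hne
    · exact ⟨(∅, ∅), Finset.mem_insert_self _ _, subset_rfl, subset_rfl⟩
    obtain ⟨L, hL, rfl⟩ := exists_convexCompacts_coe_eq hS hne
    obtain ⟨K, hK, hLK⟩ := Set.mem_iUnion₂.1 (htc hL)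
    exact ⟨p K, Finset.mem_insert_of_mem (Finset.mem_image_of_mem _ hK),
      h K (ht K hK) L hS.1 hS.2.1 hLK⟩

/-- `F`-measure of the symmetric difference is continuous in the Hausdorff distance. -/
theorem exists_measure_symmDiff_lt (hF : F ≪ volume) {K : Set Plane} (hK : K ∈ closedConvexSets)
    {η : ℝ≥0∞} (hη : 0 < η) :
    ∃ δ : ℝ, 0 < δ ∧ ∀ S ∈ closedConvexSets, hausdorffEDist S K < ENNReal.ofReal δ →
      F (symmDiff S K) < η := by
  obtain ⟨δ, hδ, l, u, -, -, hlu, h⟩ := exists_bracket_of_hausdorffEDist_lt hF hK.1 hK.2.1 hη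
  refine ⟨δ, hδ, fun S hS hSK => (measure_mono ?_).trans_lt hlu⟩
  obtain ⟨h1, h2⟩ := h S hS.1 hS.2.1 hSK
  obtain ⟨h3, h4⟩ := h K hK.1 hK.2.1 (by simpa using hδ)
  rintro x (⟨hx, hx'⟩ | ⟨hx, hx'⟩)
  · exact ⟨h2 hx, fun hl => hx' (h3 hl)⟩
  · exact ⟨h4 hx, fun hl => hx' (h1 hl)⟩

end DoseResponse

/-! ### The limiting criterion and its well-separated minimum -/

namespace DoseResponse

open TopologicalSpace Metric

/-- The integrand of the limiting criterion. -/
noncomputable def limitWeight (γ : ℝ) (S₀ : Set Plane) (x : Plane) : ℝ :=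
  (1 / 2) * S₀.indicator 1 x + S₀ᶜ.indicator 1 x - γ

theorem limitWeight_of_mem {γ : ℝ} {S₀ : Set Plane} {x : Plane} (hx : x ∈ S₀) :
    limitWeight γ S₀ x = 1 / 2 - γ := by
  simp [limitWeight, hx]

theorem limitWeight_of_notMem {γ : ℝ} {S₀ : Set Plane} {x : Plane} (hx : x ∉ S₀) :
    limitWeight γ S₀ x = 1 - γ := by
  simp [limitWeight, hx]

theorem limitCriterion_eq (F : Measure Plane) (γ : ℝ) (S₀ S : Set Plane) :
    limitCriterion F γ S₀ S = ∫ x in S, limitWeight γ S₀ x ∂F := rfl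

theorem abs_limitWeight_le_one {γ : ℝ} (hγ : γ ∈ Set.Icc (0 : ℝ) 1) (S₀ : Set Plane) (x : Plane) :
    |limitWeight γ S₀ x| ≤ 1 := by
  by_cases hx : x ∈ S₀
  · rw [limitWeight_of_mem hx, abs_le]
    constructor <;> linarith [hγ.1, hγ.2]
  · rw [limitWeight_of_notMem hx, abs_le]
    constructor <;> linarith [hγ.1, hγ.2]

theorem measurable_limitWeight (γ : ℝ) {S₀ : Set Plane} (hS₀ : MeasurableSet S₀) :
    Measurable (limitWeight γ S₀) :=
  (((measurable_one.indicator hS₀).const_mul _).add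
    (measurable_one.indicator hS₀.compl)).sub_const _

theorem limitCriterion_empty (F : Measure Plane) (γ : ℝ) (S₀ : Set Plane) :
    limitCriterion F γ S₀ ∅ = 0 := by
  simp [limitCriterion]

/-- A unique minimizer is nonempty, since the empty set and singletons give the same value. -/
theorem nonempty_of_isUniqueMinimizer {F : Measure Plane} (hF : F ≪ volume) {γ : ℝ} {S₀ : Set Plane}
    (h : IsUniqueMinimizer (limitCriterion F γ S₀) closedConvexSets S₀) : S₀.Nonempty := by
  rw [Set.nonempty_iff_ne_empty]
  intro h0
  have hmem : ({0} : Set Plane) ∈ closedConvexSets :=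
    ⟨isClosed_singleton, convex_singleton _,
      Set.singleton_subset_iff.2 ⟨le_rfl, fun _ => zero_le_one⟩⟩
  have hlt := h.2 _ hmem (by rw [h0]; exact Set.singleton_ne_empty _)
  have hz : limitCriterion F γ S₀ {0} = 0 := by
    rw [limitCriterion, Measure.restrict_eq_zero.2 (hF (measure_singleton _)),
      integral_zero_measure]
  have he : limitCriterion F γ S₀ S₀ = 0 := by
    -- Only the set of integration is rewritten; the copy of `S₀` in the weight stays.
    conv_lhs => arg 4; rw [h0]
    exact limitCriterion_empty F γ S₀
  rw [hz, he] at hlt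
  exact lt_irrefl _ hlt

variable {F : Measure Plane} [IsFiniteMeasure F]

theorem integrable_limitWeight {γ : ℝ} (hγ : γ ∈ Set.Icc (0 : ℝ) 1) {S₀ : Set Plane}
    (hS₀ : MeasurableSet S₀) : Integrable (limitWeight γ S₀) F :=
  Integrable.of_bound (measurable_limitWeight γ hS₀).aestronglyMeasurable 1
    (ae_of_all _ fun x => abs_limitWeight_le_one hγ S₀ x)

/-- The weight is bounded by `1`, and the two integrals differ only over the symmetric difference.
-/
theorem abs_limitCriterion_sub_le {γ : ℝ} (hγ : γ ∈ Set.Icc (0 : ℝ) 1) {S₀ S T : Set Plane}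
    (hS₀ : MeasurableSet S₀) (hS : MeasurableSet S) (hT : MeasurableSet T) :
    |limitCriterion F γ S₀ S - limitCriterion F γ S₀ T| ≤ F.real (symmDiff S T) := by
  have hi := integrable_limitWeight (F := F) hγ hS₀
  rw [limitCriterion_eq, limitCriterion_eq, ← integral_indicator hS, ← integral_indicator hT,
    ← integral_sub (hi.indicator hS) (hi.indicator hT), ← integral_indicator_one (hS.symmDiff hT),
    ← Real.norm_eq_abs]
  refine norm_integral_le_of_norm_le
    ((integrable_const (1 : ℝ)).indicator (hS.symmDiff hT)) (ae_of_all _ fun x => ?_)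
  have h1 := abs_limitWeight_le_one hγ S₀ x
  by_cases h : x ∈ S <;> by_cases h' : x ∈ T <;> simp [h, h', Set.mem_symmDiff, h1]

theorem continuousOn_limitCriterion (hF : F ≪ volume) {γ : ℝ} (hγ : γ ∈ Set.Icc (0 : ℝ) 1)
    {S₀ : Set Plane} (hS₀ : MeasurableSet S₀) :
    ContinuousOn (fun K : NonemptyCompacts Plane => limitCriterion F γ S₀ K) convexCompacts := by
  refine Metric.continuousOn_iff.2 fun K hK η hη => ?_
  obtain ⟨δ, hδ, h⟩ := exists_measure_symmDiff_lt hF hK (ENNReal.ofReal_pos.2 hη)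
  refine ⟨δ, hδ, fun L hL hLK => ?_⟩
  rw [← ENNReal.ofReal_lt_ofReal_iff hδ, ← edist_dist] at hLK
  refine (abs_limitCriterion_sub_le hγ hS₀ hL.1.measurableSet hK.1.measurableSet).trans_lt ?_
  exact (ENNReal.lt_ofReal_iff_toReal_lt (measure_ne_top _ _)).1 (h L hL hLK)

/-- The unique minimizer of the limiting criterion is well separated. -/
theorem exists_hausdorffEDist_lt_of_limitCriterion_lt (hF : F ≪ volume) {γ : ℝ}
    (hγ : γ ∈ Set.Icc (0 : ℝ) 1) {S₀ : Set Plane}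
    (h : IsUniqueMinimizer (limitCriterion F γ S₀) closedConvexSets S₀) {δ : ℝ} (hδ : 0 < δ) :
    ∃ η : ℝ, 0 < η ∧ ∀ S ∈ closedConvexSets,
      limitCriterion F γ S₀ S < limitCriterion F γ S₀ S₀ + η →
        hausdorffEDist S S₀ < ENNReal.ofReal δ := by
  have hne := nonempty_of_isUniqueMinimizer hF h
  -- The empty set lies outside the compact hyperspace, so its gap in criterion value is kept
  -- separately and enters the final `η`.
  have hpos : 0 < 0 - limitCriterion F γ S₀ S₀ := by
    have := h.2 _ empty_mem_closedConvexSets hne.ne_empty.symm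
    rwa [limitCriterion_empty, ← sub_pos] at this
  obtain ⟨K₀, -, hK₀⟩ := exists_convexCompacts_coe_eq h.1 hne
  have hcomp : IsCompact (convexCompacts ∩ {K | ENNReal.ofReal δ ≤ edist K K₀}) :=
    isCompact_convexCompacts.inter_right
      (isClosed_le continuous_const (continuous_id.edist continuous_const))
  have hedist : ∀ K : NonemptyCompacts Plane, edist K K₀ = hausdorffEDist (K : Set Plane) S₀ :=
    fun K => by rw [← hK₀]; rfl
  rcases (convexCompacts ∩ {K | ENNReal.ofReal δ ≤ edist K K₀}).eq_empty_or_nonempty with he | hn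
  · refine ⟨_, hpos, fun S hS hlt => ?_⟩
    rcases S.eq_empty_or_nonempty with rfl | hSne
    · rw [limitCriterion_empty] at hlt
      linarith
    obtain ⟨K, hK, rfl⟩ := exists_convexCompacts_coe_eq hS hSne
    by_contra hcon
    exact he.subset ⟨hK, by rw [Set.mem_ofPred_eq, hedist]; exact not_lt.1 hcon⟩
  · obtain ⟨L, ⟨hL, hLd⟩, hmin⟩ := hcomp.exists_isMinOn hn
      ((continuousOn_limitCriterion hF hγ h.1.1.measurableSet).mono Set.inter_subset_left)
    have hLne : (L : Set Plane) ≠ S₀ := by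
      intro hLS
      rw [Set.mem_ofPred_eq, hedist, hLS, hausdorffEDist_self] at hLd
      exact (ENNReal.ofReal_pos.2 hδ).not_ge hLd
    refine ⟨_, lt_min hpos (sub_pos.2 (h.2 _ hL hLne)), fun S hS hlt => ?_⟩
    rcases S.eq_empty_or_nonempty with rfl | hSne
    · rw [limitCriterion_empty] at hlt
      linarith [min_le_left (0 - limitCriterion F γ S₀ S₀)
        (limitCriterion F γ S₀ L - limitCriterion F γ S₀ S₀)]
    obtain ⟨K, hK, rfl⟩ := exists_convexCompacts_coe_eq hS hSne
    by_contra hcon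
    have h1 : limitCriterion F γ S₀ L ≤ limitCriterion F γ S₀ K :=
      hmin ⟨hK, by rw [Set.mem_ofPred_eq, hedist]; exact not_lt.1 hcon⟩
    linarith [min_le_right (0 - limitCriterion F γ S₀ S₀)
        (limitCriterion F γ S₀ L - limitCriterion F γ S₀ S₀)]

end DoseResponse

/-! ### The normal distribution function under weak limits -/

namespace DoseResponse

theorem continuous_stdNormalCDF : Continuous stdNormalCDF := by
  refine continuous_iff_continuousAt.2 fun t => ?_
  have := nullSingletonClass_gaussianReal (μ := 0) one_ne_zero
  have hm : Monotone (cdf (gaussianReal 0 1)) := monotone_cdf _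
  have h := (cdf (gaussianReal 0 1)).measure_singleton t
  rw [measure_cdf, measure_singleton, eq_comm, ENNReal.ofReal_eq_zero] at h
  refine hm.continuousAt_iff_leftLim_eq_rightLim.2 ?_
  rw [StieltjesFunction.rightLim_eq]
  exact le_antisymm (hm.leftLim_le le_rfl) (by linarith)

theorem stdNormalCDF_nonneg (t : ℝ) : 0 ≤ stdNormalCDF t := cdf_nonneg _ _

theorem stdNormalCDF_le_one (t : ℝ) : stdNormalCDF t ≤ 1 := cdf_le_one _ _

theorem monotone_stdNormalCDF : Monotone stdNormalCDF := monotone_cdf _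

theorem norm_stdNormalCDF_le_one (t : ℝ) : ‖stdNormalCDF t‖ ≤ 1 := by
  rw [Real.norm_of_nonneg (stdNormalCDF_nonneg t)]
  exact stdNormalCDF_le_one t

theorem stdNormalCDF_neg (t : ℝ) : stdNormalCDF (-t) = 1 - stdNormalCDF t := by
  have := nullSingletonClass_gaussianReal (μ := 0) one_ne_zero
  rw [stdNormalCDF, stdNormalCDF, cdf_eq_real, cdf_eq_real,
    ← probReal_compl_eq_one_sub measurableSet_Iic]
  have h : gaussianReal 0 1 = (gaussianReal 0 1).map (fun x => -x) := by
    rw [gaussianReal_map_neg, neg_zero]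
  rw [h, map_measureReal_apply measurable_neg measurableSet_Iic, ← h]
  have : (fun x : ℝ => -x) ⁻¹' Set.Iic (-t) = Set.Ici t := by ext; simp
  rw [this, Set.compl_Iic]
  exact measureReal_congr Ioi_ae_eq_Ici.symm

theorem integrable_stdNormalCDF_comp {α : Type*} [MeasurableSpace α] {ρ : Measure α}
    [IsFiniteMeasure ρ] {g : α → ℝ} (hg : AEMeasurable g ρ) :
    Integrable (fun x => stdNormalCDF (g x)) ρ :=
  Integrable.of_bound (continuous_stdNormalCDF.measurable.comp_aemeasurable hg).aestronglyMeasurable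
    1 (ae_of_all _ fun _ => norm_stdNormalCDF_le_one _)

/-- Symmetry of the law turns `Φ` into `1 - Φ`. This is the origin of the weight `1/2` on `S₀`; the
variance is arbitrary, zero included. -/
theorem integral_stdNormalCDF_gaussianReal (v : ℝ≥0) :
    ∫ t, stdNormalCDF t ∂gaussianReal 0 v = 1 / 2 := by
  have h : gaussianReal 0 v = (gaussianReal 0 v).map (fun x => -x) := by
    rw [gaussianReal_map_neg, neg_zero]
  have h1 : ∫ t, stdNormalCDF t ∂gaussianReal 0 v
      = ∫ t, (1 - stdNormalCDF t) ∂gaussianReal 0 v := by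
    conv_lhs => rw [h]
    rw [integral_map measurable_neg.aemeasurable
      continuous_stdNormalCDF.aestronglyMeasurable]
    simp_rw [stdNormalCDF_neg]
  rw [integral_sub (integrable_const _)
    (integrable_stdNormalCDF_comp (g := fun t => t) aemeasurable_id)] at h1
  simp at h1
  linarith

section WeakLimit

variable {ρ : ℕ → ProbabilityMeasure ℝ} {ρ' : ProbabilityMeasure ℝ}

theorem tendsto_integral_stdNormalCDF_add (h : Tendsto ρ atTop (𝓝 ρ')) (c : ℝ) :
    Tendsto (fun m => ∫ t, stdNormalCDF (c + t) ∂(ρ m : Measure ℝ)) atTop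
      (𝓝 (∫ t, stdNormalCDF (c + t) ∂(ρ' : Measure ℝ))) :=
  ProbabilityMeasure.tendsto_iff_forall_integral_tendsto.1 h
    (BoundedContinuousFunction.ofNormedAddCommGroup (fun t => stdNormalCDF (c + t))
      (continuous_stdNormalCDF.comp (continuous_const.add continuous_id)) 1
      fun _ => norm_stdNormalCDF_le_one _)

/-- Since the measure varies with `m`, the shift is first frozen at a large `c`: weak convergence
handles the fixed shift, and monotonicity of `Φ` carries the bound to every `a m ≥ c`. -/
theorem tendsto_integral_stdNormalCDF_add_atTop (h : Tendsto ρ atTop (𝓝 ρ')) {a : ℕ → ℝ}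
    (ha : Tendsto a atTop atTop) :
    Tendsto (fun m => ∫ t, stdNormalCDF (a m + t) ∂(ρ m : Measure ℝ)) atTop (𝓝 1) := by
  have hle : ∀ m, ∫ t, stdNormalCDF (a m + t) ∂(ρ m : Measure ℝ) ≤ 1 := fun m => by
    refine (integral_mono (integrable_stdNormalCDF_comp (by fun_prop)) (integrable_const 1)
      fun t => stdNormalCDF_le_one _).trans (by simp)
  have hlim : Tendsto (fun c : ℕ => ∫ t, stdNormalCDF (c + t) ∂(ρ' : Measure ℝ)) atTop (𝓝 1) := by
    have : (1 : ℝ) = ∫ _, (1 : ℝ) ∂(ρ' : Measure ℝ) := by simp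
    rw [this]
    refine tendsto_integral_of_dominated_convergence (fun _ => 1)
      (fun c => (integrable_stdNormalCDF_comp (by fun_prop)).aestronglyMeasurable)
      (integrable_const _) (fun c => ae_of_all _ fun t => norm_stdNormalCDF_le_one _)
      (ae_of_all _ fun t => ?_)
    exact (tendsto_cdf_atTop _).comp
      (tendsto_atTop_add_const_right _ _ tendsto_natCast_atTop_atTop)
  refine tendsto_order.2 ⟨fun b hb => ?_, fun b hb => Eventually.of_forall fun m =>
    (hle m).trans_lt hb⟩
  obtain ⟨c, hc⟩ := (hlim.eventually (lt_mem_nhds hb)).exists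
  filter_upwards [(tendsto_integral_stdNormalCDF_add h c).eventually (lt_mem_nhds hc),
    ha.eventually_ge_atTop (c : ℝ)] with m hm ham
  refine hm.trans_le (integral_mono (integrable_stdNormalCDF_comp (by fun_prop))
    (integrable_stdNormalCDF_comp (by fun_prop)) fun t => monotone_stdNormalCDF (by gcongr))

end WeakLimit

end DoseResponse

/-! ### Row sums of errors: independence, laws, central limit theorem -/

namespace DoseResponse

variable {Ω : Type*} [MeasurableSpace Ω] {P : Measure Ω}

/-- The normalized sum of the first `m` entries of a row of errors. -/
noncomputable def scaledRowSum (ε : ℕ → ℕ → Ω → ℝ) (m i : ℕ) (ω : Ω) : ℝ :=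
  (Real.sqrt m)⁻¹ * ∑ k ∈ Finset.range m, ε i k ω

theorem sqrt_mul_rowMean_sub (m : ℕ) (y e : ℕ → ℝ) (a τ₀ : ℝ) (hy : ∀ j, y j = a + e j) :
    Real.sqrt m * (rowMean m y - τ₀)
      = Real.sqrt m * (a - τ₀) + (Real.sqrt m)⁻¹ * ∑ k ∈ Finset.range m, e k := by
  -- For `m = 0` both sides are `0`.
  rcases Nat.eq_zero_or_pos m with rfl | hm
  · simp
  have hm' : (0 : ℝ) < m := Nat.cast_pos.2 hm
  have hs : 0 < Real.sqrt m := Real.sqrt_pos.2 hm'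
  have h1 : rowMean m y = a + (∑ k ∈ Finset.range m, e k) / m := by
    simp_rw [rowMean, hy, Finset.sum_add_distrib]
    simp
    field_simp
  have h2 : (m : ℝ) = Real.sqrt m * Real.sqrt m := (Real.mul_self_sqrt hm'.le).symm
  have h3 : Real.sqrt m * ((∑ k ∈ Finset.range m, e k) / m)
      = (Real.sqrt m)⁻¹ * ∑ k ∈ Finset.range m, e k := by
    conv_lhs => arg 2; rw [h2]
    field_simp
  rw [h1, ← h3]
  ring

theorem measurable_scaledRowSum {ε : ℕ → ℕ → Ω → ℝ} (hε : ∀ i j, Measurable (ε i j))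
    (m i : ℕ) : Measurable (scaledRowSum ε m i) :=
  (Finset.measurable_fun_sum _ fun k _ => hε i k).const_mul _

theorem iIndepFun_row {ε : ℕ → ℕ → Ω → ℝ}
    (hε_indep : iIndepFun (fun p : ℕ × ℕ => ε p.1 p.2) P) (i : ℕ) : iIndepFun (ε i) P :=
  hε_indep.precomp (g := fun j => (i, j)) fun _ _ h => (Prod.ext_iff.1 h).2

/-- Distinct rows are functions of disjoint finite blocks of the independent array. -/
theorem indepFun_scaledRowSum {ε : ℕ → ℕ → Ω → ℝ} (hε : ∀ i j, Measurable (ε i j))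
    (hε_indep : iIndepFun (fun p : ℕ × ℕ => ε p.1 p.2) P) (m : ℕ) {i j : ℕ} (hij : i ≠ j) :
    IndepFun (scaledRowSum ε m i) (scaledRowSum ε m j) P := by
  classical
  have hdisj : Disjoint ({i} ×ˢ Finset.range m) ({j} ×ˢ Finset.range m) := by
    rw [Finset.disjoint_left]
    rintro ⟨a, b⟩ h1 h2
    simp only [Finset.mem_product, Finset.mem_singleton] at h1 h2
    exact hij (h1.1.symm.trans h2.1)
  have h := hε_indep.indepFun_finset _ _ hdisj fun p => hε p.1 p.2
  have key : ∀ i : ℕ, ∃ ψ : (({i} ×ˢ Finset.range m : Finset (ℕ × ℕ)) → ℝ) → ℝ, Measurable ψ ∧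
      scaledRowSum ε m i = ψ ∘ fun ω p => ε (p : ℕ × ℕ).1 (p : ℕ × ℕ).2 ω := fun i => by
    refine ⟨fun z => (Real.sqrt m)⁻¹ * ∑ p, z p, by fun_prop, ?_⟩
    funext ω
    have := Finset.sum_coe_sort ({i} ×ˢ Finset.range m) fun p : ℕ × ℕ => ε p.1 p.2 ω
    simp only [Function.comp_apply, scaledRowSum]
    rw [this, Finset.sum_product]
    simp
  obtain ⟨ψ, hψ, e1⟩ := key i
  obtain ⟨ψ', hψ', e2⟩ := key j
  rw [e1, e2]
  exact h.comp hψ hψ'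

variable [IsProbabilityMeasure P]

/-- A weak law of large numbers for bounded variables, with a bound that does not depend on their
law. -/
theorem measure_le_abs_average_sub_le {Z : ℕ → Ω → ℝ} (hZ : ∀ i, AEMeasurable (Z i) P)
    (hb : ∀ i ω, |Z i ω| ≤ 1) (hind : Pairwise fun i j => IndepFun (Z i) (Z j) P) {e : ℝ}
    (he : ∀ i, ∫ ω, Z i ω ∂P = e) {δ : ℝ} (hδ : 0 < δ) {n : ℕ} (hn : 0 < n) :
    P {ω | δ ≤ |(∑ i ∈ Finset.range n, Z i ω) / n - e|} ≤ ENNReal.ofReal (1 / (n * δ ^ 2)) := by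
  have hn' : (0 : ℝ) < n := Nat.cast_pos.2 hn
  have hL : ∀ i, MemLp (Z i) 2 P := fun i =>
    MemLp.of_bound (hZ i).aestronglyMeasurable 1 (ae_of_all _ (hb i))
  have hmean : ∫ ω, (∑ i ∈ Finset.range n, Z i) ω ∂P = n * e := by
    simp_rw [Finset.sum_apply]
    rw [integral_finsetSum _ fun i _ => (hL i).integrable one_le_two]
    simp [he]
  have hvar : variance (∑ i ∈ Finset.range n, Z i) P ≤ n := by
    rw [IndepFun.variance_sum (fun i _ => hL i) fun i _ j _ hij => hind hij]
    calc ∑ i ∈ Finset.range n, variance (Z i) P ≤ ∑ i ∈ Finset.range n, (1 : ℝ) := by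
          refine Finset.sum_le_sum fun i _ => ?_
          refine (variance_le_sq_of_bounded (a := -1) (b := 1)
            (ae_of_all _ fun ω => abs_le.1 (hb i ω)) (hZ i)).trans (by norm_num)
      _ = n := by simp
  have hch := meas_ge_le_variance_div_sq (μ := P)
    (memLp_finsetSum' (Finset.range n) fun i _ => hL i) (mul_pos hn' hδ)
  rw [hmean] at hch
  refine (measure_mono fun ω hω => ?_).trans (hch.trans (ENNReal.ofReal_le_ofReal ?_))
  · have h : (∑ i ∈ Finset.range n, Z i) ω - n * e
        = n * ((∑ i ∈ Finset.range n, Z i ω) / n - e) := by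
      rw [Finset.sum_apply]
      field_simp
    change n * δ ≤ |(∑ i ∈ Finset.range n, Z i) ω - n * e|
    rw [h, abs_mul, abs_of_pos hn']
    exact mul_le_mul_of_nonneg_left hω hn'.le
  · calc variance (∑ i ∈ Finset.range n, Z i) P / (n * δ) ^ 2 ≤ n / (n * δ) ^ 2 := by gcongr
      _ = 1 / (n * δ ^ 2) := by field_simp

/-- Pairs built from two independent couples of independent variables are independent. -/
theorem indepFun_prodMk_of_indepFun {α β : Type*} [MeasurableSpace α] [MeasurableSpace β]
    {U U' : Ω → α} {V V' : Ω → β} (hU : Measurable U) (hU' : Measurable U') (hV : Measurable V)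
    (hV' : Measurable V') (hUU' : IndepFun U U' P) (hVV' : IndepFun V V' P)
    (h : IndepFun (fun ω => (U ω, U' ω)) (fun ω => (V ω, V' ω)) P) :
    IndepFun (fun ω => (U ω, V ω)) (fun ω => (U' ω, V' ω)) P := by
  have hgen : ∀ g : Ω → α × β, MeasurableSpace.comap g inferInstance =
      MeasurableSpace.generateFrom (Set.preimage g ''
        Set.image2 (· ×ˢ ·) {s : Set α | MeasurableSet s} {t : Set β | MeasurableSet t}) :=
    fun g => by rw [← MeasurableSpace.comap_generateFrom, generateFrom_prod]
  have hpi : ∀ g : Ω → α × β, IsPiSystem (Set.preimage g ''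
        Set.image2 (· ×ˢ ·) {s : Set α | MeasurableSet s} {t : Set β | MeasurableSet t}) := by
    rintro g _ ⟨s, hs, rfl⟩ _ ⟨t, ht, rfl⟩ hst
    exact ⟨s ∩ t, isPiSystem_prod s hs t ht (by
      obtain ⟨ω, h1, h2⟩ := hst
      exact ⟨g ω, h1, h2⟩), rfl⟩
  have hUV : IndepFun U V P := h.comp measurable_fst measurable_fst
  have hUV' : IndepFun U' V' P := h.comp measurable_snd measurable_snd
  refine IndepSets.indep (hU.prodMk hV).comap_le (hU'.prodMk hV').comap_le (hpi _) (hpi _)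
    (hgen _) (hgen _) ((IndepSets_iff _ _ P).2 ?_)
  rintro _ _ ⟨_, ⟨s, hs, t, ht, rfl⟩, rfl⟩ ⟨_, ⟨s', hs', t', ht', rfl⟩, rfl⟩
  have e1 := hUV.measure_inter_preimage_eq_mul s t hs ht
  have e2 := hUV'.measure_inter_preimage_eq_mul s' t' hs' ht'
  have e3 := hUU'.measure_inter_preimage_eq_mul s s' hs hs'
  have e4 := hVV'.measure_inter_preimage_eq_mul t t' ht ht'
  have e5 := h.measure_inter_preimage_eq_mul (s ×ˢ s') (t ×ˢ t') (hs.prod hs') (ht.prod ht')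
  simp only [Set.mk_preimage_prod] at e5 ⊢
  rw [e1, e2, Set.inter_inter_inter_comm, e5, e3, e4]
  ring

/-- The characteristic function of the normalized sum depends only on `m` and the common law of the
errors. -/
theorem map_scaledRowSum_eq {ε : ℕ → ℕ → Ω → ℝ} (hε : ∀ i j, Measurable (ε i j))
    (hε_indep : iIndepFun (fun p : ℕ × ℕ => ε p.1 p.2) P)
    (hε_ident : ∀ i j, IdentDistrib (ε i j) (ε 0 0) P P) (m i : ℕ) :
    P.map (scaledRowSum ε m i) = P.map (scaledRowSum ε m 0) := by
  have hid : ∀ i j, IdentDistrib (ε i j) (ε i 0) P P := fun i j =>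
    (hε_ident i j).trans (hε_ident i 0).symm
  have := Measure.isProbabilityMeasure_map (μ := P) (measurable_scaledRowSum hε m i).aemeasurable
  have := Measure.isProbabilityMeasure_map (μ := P) (measurable_scaledRowSum hε m 0).aemeasurable
  refine Measure.ext_of_charFun (funext fun t => ?_)
  have h := fun i => charFun_inv_sqrt_mul_sum (iIndepFun_row hε_indep i) (hid i) (n := m) (t := t)
  refine (h i).trans (Eq.trans ?_ (h 0).symm)
  rw [(hε_ident i 0).map_eq]

/-- The law of the normalized sum of a row of errors. -/
noncomputable def scaledRowSumLaw (P : Measure Ω) [IsProbabilityMeasure P] {ε : ℕ → ℕ → Ω → ℝ}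
    (hε : ∀ i j, Measurable (ε i j)) (m : ℕ) : ProbabilityMeasure ℝ :=
  ⟨P.map (scaledRowSum ε m 0),
    Measure.isProbabilityMeasure_map (measurable_scaledRowSum hε m 0).aemeasurable⟩

theorem tendsto_scaledRowSumLaw {ε : ℕ → ℕ → Ω → ℝ} (hε : ∀ i j, Measurable (ε i j))
    (hε_indep : iIndepFun (fun p : ℕ × ℕ => ε p.1 p.2) P)
    (hε_ident : ∀ i j, IdentDistrib (ε i j) (ε 0 0) P P)
    (hε_var : MemLp (ε 0 0) 2 P) (hε_mean : ∫ ω, ε 0 0 ω ∂P = 0) :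
    Tendsto (scaledRowSumLaw P hε) atTop
      (𝓝 ⟨gaussianReal 0 (variance (ε 0 0) P).toNNReal, inferInstance⟩) := by
  have h := tendstoInDistribution_inv_sqrt_mul_sum_sub (X := ε 0) (Y := id)
    (P' := gaussianReal 0 (variance (ε 0 0) P).toNNReal) HasLaw.id hε_var
    (iIndepFun_row hε_indep 0) (hε_ident 0)
  have ht := h.tendsto
  simp only [hε_mean, mul_zero, sub_zero, Measure.map_id] at ht
  exact ht

end DoseResponse

/-! ### Mean of a summand and the law of large numbers -/

namespace DoseResponse

/-- The summand of the empirical criterion, as a function of the covariate and of the normalized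
row sum of the errors. -/
noncomputable def summand (g : Plane → ℝ) (τ₀ γ : ℝ) (A : Set Plane) (m : ℕ) (p : Plane × ℝ) : ℝ :=
  (stdNormalCDF (Real.sqrt m * (g p.1 - τ₀) + p.2) - γ) * A.indicator 1 p.1

theorem abs_stdNormalCDF_sub_le_one {γ : ℝ} (hγ : γ ∈ Set.Icc (0 : ℝ) 1) (t : ℝ) :
    |stdNormalCDF t - γ| ≤ 1 := by
  rw [abs_le]
  constructor <;> linarith [hγ.1, hγ.2, stdNormalCDF_nonneg t, stdNormalCDF_le_one t]

theorem abs_summand_le_one {γ : ℝ} (hγ : γ ∈ Set.Icc (0 : ℝ) 1) (g : Plane → ℝ) (τ₀ : ℝ)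
    (A : Set Plane) (m : ℕ) (p : Plane × ℝ) : |summand g τ₀ γ A m p| ≤ 1 := by
  rw [summand]
  by_cases h : p.1 ∈ A
  · simpa [h] using abs_stdNormalCDF_sub_le_one hγ _
  · simp [h]

theorem measurable_summand {g : Plane → ℝ} (hg : Measurable g) (τ₀ γ : ℝ) {A : Set Plane}
    (hA : MeasurableSet A) (m : ℕ) : Measurable (summand g τ₀ γ A m) := by
  refine ((continuous_stdNormalCDF.measurable.comp ?_).sub_const _).mul
    ((measurable_one.indicator hA).comp measurable_fst)
  fun_prop

theorem integrable_summand {ρ : Measure (Plane × ℝ)} [IsFiniteMeasure ρ] {g : Plane → ℝ}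
    (hg : Measurable g) (τ₀ : ℝ) {γ : ℝ} (hγ : γ ∈ Set.Icc (0 : ℝ) 1) {A : Set Plane}
    (hA : MeasurableSet A) (m : ℕ) : Integrable (summand g τ₀ γ A m) ρ :=
  Integrable.of_bound (measurable_summand hg τ₀ γ hA m).aestronglyMeasurable 1
    (ae_of_all _ fun p => abs_summand_le_one hγ g τ₀ A m p)

/-- The expectation of the summand converges to the limiting criterion. -/
theorem tendsto_integral_summand {F : Measure Plane} [IsFiniteMeasure F]
    {ρ : ℕ → ProbabilityMeasure ℝ} {v : ℝ≥0}
    (hρ : Tendsto ρ atTop (𝓝 ⟨gaussianReal 0 v, inferInstance⟩)) {g : Plane → ℝ}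
    (hg : Measurable g) {τ₀ : ℝ} {S₀ : Set Plane}
    (hg_base : ∀ x ∈ S₀, g x = τ₀) (hg_pos : ∀ᵐ x ∂F, x ∉ S₀ → τ₀ < g x) {γ : ℝ}
    (hγ : γ ∈ Set.Icc (0 : ℝ) 1) {A : Set Plane} (hA : MeasurableSet A) :
    Tendsto (fun m => ∫ p, summand g τ₀ γ A m p ∂(F.prod (ρ m : Measure ℝ))) atTop
      (𝓝 (limitCriterion F γ S₀ A)) := by
  rw [limitCriterion_eq, ← integral_indicator hA]
  have hfub : ∀ m, ∫ p, summand g τ₀ γ A m p ∂(F.prod (ρ m : Measure ℝ))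
      = ∫ x, ∫ t, summand g τ₀ γ A m (x, t) ∂(ρ m : Measure ℝ) ∂F := fun m =>
    integral_prod _ (integrable_summand hg τ₀ hγ hA m)
  simp_rw [hfub]
  refine tendsto_integral_of_dominated_convergence (fun _ => 1) (fun m => ?_)
    (integrable_const _) (fun m => ae_of_all _ fun x => ?_) ?_
  · exact (measurable_summand hg τ₀ γ hA m).stronglyMeasurable.integral_prod_right'
      |>.aestronglyMeasurable
  · refine (norm_integral_le_of_norm_le (integrable_const (1 : ℝ))
      (ae_of_all _ fun t => abs_summand_le_one hγ g τ₀ A m (x, t))).trans (by simp)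
  · filter_upwards [hg_pos] with x hx
    by_cases hxA : x ∈ A
    swap
    · simp [summand, hxA]
    have hint : ∀ m, ∫ t, summand g τ₀ γ A m (x, t) ∂(ρ m : Measure ℝ)
        = ∫ t, stdNormalCDF (Real.sqrt m * (g x - τ₀) + t) ∂(ρ m : Measure ℝ) - γ := fun m => by
      simp only [summand, Set.indicator_of_mem hxA, Pi.one_apply, mul_one]
      rw [integral_sub (integrable_stdNormalCDF_comp (by fun_prop)) (integrable_const _)]
      simp
    simp_rw [hint, Set.indicator_of_mem hxA]
    -- On `S₀` there is no drift and the central limit theorem alone acts; elsewhere the drift is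
    -- `√m` times a positive constant.
    by_cases hxS : x ∈ S₀
    · rw [limitWeight_of_mem hxS, ← integral_stdNormalCDF_gaussianReal v]
      simp_rw [hg_base x hxS, sub_self, mul_zero]
      refine Tendsto.sub_const ?_ _
      simpa using tendsto_integral_stdNormalCDF_add hρ 0
    · rw [limitWeight_of_notMem hxS]
      refine Tendsto.sub_const (tendsto_integral_stdNormalCDF_add_atTop hρ ?_) _
      exact (Real.tendsto_sqrt_atTop.comp tendsto_natCast_atTop_atTop).atTop_mul_const
        (sub_pos.2 (hx hxS))

variable {Ω : Type*} [MeasurableSpace Ω] {P : Measure Ω} [IsProbabilityMeasure P]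

/-- Convergence in probability of averages of bounded pairwise independent variables, whose common
expectation depends on a first index and converges. -/
theorem tendsto_measure_average_sub {Z : ℕ → ℕ → Ω → ℝ} (hZ : ∀ m i, AEMeasurable (Z m i) P)
    (hb : ∀ m i ω, |Z m i ω| ≤ 1) (hind : ∀ m, Pairwise fun i j => IndepFun (Z m i) (Z m j) P)
    {e : ℕ → ℝ} (he : ∀ m i, ∫ ω, Z m i ω ∂P = e m) {e' : ℝ} (he' : Tendsto e atTop (𝓝 e'))
    {δ : ℝ} (hδ : 0 < δ) :
    Tendsto (fun p : ℕ × ℕ => P {ω | δ ≤ |(∑ i ∈ Finset.range p.2, Z p.1 i ω) / p.2 - e'|})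
      (comap (fun p : ℕ × ℕ => min p.1 p.2) atTop) (𝓝 0) := by
  have hmin : Tendsto (fun p : ℕ × ℕ => min p.1 p.2)
      (comap (fun p : ℕ × ℕ => min p.1 p.2) atTop) atTop := tendsto_comap
  have h1 : Tendsto (fun p : ℕ × ℕ => p.1) (comap (fun p : ℕ × ℕ => min p.1 p.2) atTop) atTop :=
    tendsto_atTop_mono (fun p => min_le_left _ _) hmin
  have h2 : Tendsto (fun p : ℕ × ℕ => p.2) (comap (fun p : ℕ × ℕ => min p.1 p.2) atTop) atTop :=
    tendsto_atTop_mono (fun p => min_le_right _ _) hmin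
  -- Half of `δ` pays for the bias `e m - e'`, half for the Chebyshev deviation. The latter bound is
  -- free of `m`, so no rate linking `m` and `n` is needed.
  have hbound : Tendsto (fun n : ℕ => ENNReal.ofReal (1 / (n * (δ / 2) ^ 2))) atTop (𝓝 0) := by
    rw [← ENNReal.ofReal_zero]
    refine ENNReal.tendsto_ofReal (tendsto_const_nhds.div_atTop ?_)
    exact tendsto_natCast_atTop_atTop.atTop_mul_const (by positivity)
  refine tendsto_of_tendsto_of_tendsto_of_le_of_le' tendsto_const_nhds (hbound.comp h2)
    (Eventually.of_forall fun _ => zero_le) ?_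
  filter_upwards [(he'.comp h1).eventually (Metric.ball_mem_nhds e' (half_pos hδ)),
    h2.eventually_gt_atTop 0] with p hp1 hp2
  refine (measure_mono fun ω hω => ?_).trans (measure_le_abs_average_sub_le (hZ p.1) (hb p.1)
    (hind p.1) (he p.1) (half_pos hδ) hp2)
  have h3 : |e p.1 - e'| < δ / 2 := hp1
  have h4 : δ ≤ |(∑ i ∈ Finset.range p.2, Z p.1 i ω) / p.2 - e'| := hω
  have h5 := abs_sub_le ((∑ i ∈ Finset.range p.2, Z p.1 i ω) / p.2) (e p.1) e'
  change δ / 2 ≤ |(∑ i ∈ Finset.range p.2, Z p.1 i ω) / p.2 - e p.1|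
  linarith

end DoseResponse

/-! ### Convergence of the criterion on a fixed set -/

namespace DoseResponse

section Deterministic

/-- The proportion of the first `n` covariates lying in `A`. -/
noncomputable def empiricalMass (n : ℕ) (x : ℕ → Plane) (A : Set Plane) : ℝ :=
  (∑ i ∈ Finset.range n, A.indicator (1 : Plane → ℝ) (x i)) / n

/-- The weights are at most `1` in absolute value. The bound involves only the bracket, hence is
uniform over the sets `S` inside it. -/
theorem abs_empiricalCriterion_sub_le (τ₀ : ℝ) {γ : ℝ} (hγ : γ ∈ Set.Icc (0 : ℝ) 1) (m n : ℕ)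
    (x : ℕ → Plane) (y : ℕ → ℕ → ℝ) {l S u : Set Plane} (hl : l ⊆ S) (hu : S ⊆ u) :
    |empiricalCriterion τ₀ γ m n x y S - empiricalCriterion τ₀ γ m n x y l|
      ≤ empiricalMass n x (u \ l) := by
  rw [empiricalCriterion, empiricalCriterion, empiricalMass, ← sub_div, ← Finset.sum_sub_distrib,
    abs_div, Nat.abs_cast]
  refine div_le_div_of_nonneg_right ((Finset.abs_sum_le_sum_abs _ _).trans
    (Finset.sum_le_sum fun i _ => ?_)) n.cast_nonneg
  by_cases h1 : x i ∈ l
  · simp [h1, hl h1]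
  by_cases h2 : x i ∈ S
  · simpa [h1, h2, hu h2] using abs_stdNormalCDF_sub_le_one hγ _
  · simpa [h1, h2] using Set.indicator_nonneg (f := (1 : Plane → ℝ)) (fun _ _ => zero_le_one) _

/-- Replacing `S` by `l` costs the empirical mass of `u \ l` in one criterion and at most its
`F`-mass in the other; comparing the empirical mass with the `F`-mass gives the factor `2`. -/
theorem abs_empiricalCriterion_sub_limitCriterion_le {F : Measure Plane} [IsFiniteMeasure F]
    (τ₀ : ℝ) {γ : ℝ} (hγ : γ ∈ Set.Icc (0 : ℝ) 1) (m n : ℕ) (x : ℕ → Plane) (y : ℕ → ℕ → ℝ)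
    {S₀ l S u : Set Plane} (hS₀ : MeasurableSet S₀) (hlm : MeasurableSet l)
    (hSm : MeasurableSet S) (hl : l ⊆ S) (hu : S ⊆ u) :
    |empiricalCriterion τ₀ γ m n x y S - limitCriterion F γ S₀ S|
      ≤ |empiricalCriterion τ₀ γ m n x y l - limitCriterion F γ S₀ l|
        + |empiricalMass n x (u \ l) - F.real (u \ l)| + 2 * F.real (u \ l) := by
  have h1 := abs_empiricalCriterion_sub_le τ₀ hγ m n x y hl hu
  have h2 : |limitCriterion F γ S₀ l - limitCriterion F γ S₀ S| ≤ F.real (u \ l) :=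
    (abs_limitCriterion_sub_le hγ hS₀ hlm hSm).trans (measureReal_mono (by
      rintro z (⟨hz, hz'⟩ | ⟨hz, hz'⟩)
      · exact absurd (hl hz) hz'
      · exact ⟨hu hz, hz'⟩))
  have h3 := le_abs_self (empiricalMass n x (u \ l) - F.real (u \ l))
  have h4 := abs_sub_le (empiricalCriterion τ₀ γ m n x y S) (empiricalCriterion τ₀ γ m n x y l)
    (limitCriterion F γ S₀ S)
  have h5 := abs_sub_le (empiricalCriterion τ₀ γ m n x y l) (limitCriterion F γ S₀ l)
    (limitCriterion F γ S₀ S)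
  linarith

/-- A minimizer of a criterion uniformly close to the limiting one is nearly optimal for the
latter. -/
theorem lt_add_of_isMinimizer {M M' : Set Plane → ℝ} {𝒮 : Set (Set Plane)} {S S₀ : Set Plane}
    (hS : IsMinimizer M 𝒮 S) (hS₀ : S₀ ∈ 𝒮) {η : ℝ} (h : ∀ T ∈ 𝒮, |M T - M' T| < η / 2) :
    M' S < M' S₀ + η := by
  have h1 := (abs_lt.1 (h S hS.1)).1
  have h2 := (abs_lt.1 (h S₀ hS₀)).2
  linarith [hS.2 S₀ hS₀]

end Deterministic

variable {Ω : Type*} [MeasurableSpace Ω] {P : Measure Ω} [IsProbabilityMeasure P]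

theorem tendsto_measure_empiricalMass_sub {F : Measure Plane} {X : ℕ → Ω → Plane}
    (hX : ∀ i, Measurable (X i)) (hX_law : ∀ i, P.map (X i) = F) (hX_indep : iIndepFun X P)
    {A : Set Plane} (hA : MeasurableSet A) {δ : ℝ} (hδ : 0 < δ) :
    Tendsto (fun p : ℕ × ℕ =>
        P {ω | δ ≤ |empiricalMass p.2 (fun i => X i ω) A - F.real A|})
      (comap (fun p : ℕ × ℕ => min p.1 p.2) atTop) (𝓝 0) := by
  have hm : Measurable (A.indicator (1 : Plane → ℝ)) := measurable_one.indicator hA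
  refine tendsto_measure_average_sub (Z := fun _ i ω => A.indicator 1 (X i ω))
    (e := fun _ => F.real A) (fun _ i => (hm.comp (hX i)).aemeasurable) (fun _ i ω => ?_)
    (fun _ i j hij => (hX_indep.indepFun hij).comp hm hm) (fun _ i => ?_) tendsto_const_nhds hδ
  · by_cases h : X i ω ∈ A <;> simp [h]
  · rw [← integral_map (hX i).aemeasurable hm.aestronglyMeasurable, hX_law i,
      integral_indicator_one hA]

theorem tendsto_measure_empiricalCriterion_sub {F : Measure Plane}
    (hF : ∀ᵐ x ∂F, x ∈ unitSquare) {μ : Plane → ℝ} (hμ : ContinuousOn μ unitSquare)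
    {τ₀ : ℝ} {S₀ : Set Plane} (hS₀ : S₀ ⊆ unitSquare) (hμ_base : ∀ x ∈ S₀, μ x = τ₀)
    (hμ_pos : ∀ x ∈ unitSquare, x ∉ S₀ → τ₀ < μ x)
    {X : ℕ → Ω → Plane} (hX : ∀ i, Measurable (X i))
    (hX_law : ∀ i, P.map (X i) = F) (hX_indep : iIndepFun X P)
    {ε : ℕ → ℕ → Ω → ℝ} (hε : ∀ i j, Measurable (ε i j))
    (hε_indep : iIndepFun (fun p : ℕ × ℕ => ε p.1 p.2) P)
    (hε_ident : ∀ i j, IdentDistrib (ε i j) (ε 0 0) P P)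
    (hε_var : MemLp (ε 0 0) 2 P) (hε_mean : ∫ ω, ε 0 0 ω ∂P = 0)
    (hXε : IndepFun (fun ω (i : ℕ) => X i ω) (fun ω (p : ℕ × ℕ) => ε p.1 p.2 ω) P)
    {Y : ℕ → ℕ → Ω → ℝ} (hY : ∀ i j ω, Y i j ω = μ (X i ω) + ε i j ω)
    {γ : ℝ} (hγ : γ ∈ Set.Icc (0 : ℝ) 1) {A : Set Plane} (hA : MeasurableSet A)
    {δ : ℝ} (hδ : 0 < δ) :
    Tendsto (fun p : ℕ × ℕ => P {ω | δ ≤ |empiricalCriterion τ₀ γ p.1 p.2 (fun i => X i ω)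
        (fun i j => Y i j ω) A - limitCriterion F γ S₀ A|})
      (comap (fun p : ℕ × ℕ => min p.1 p.2) atTop) (𝓝 0) := by
  classical
  have : IsProbabilityMeasure F := by
    rw [← hX_law 0]
    exact Measure.isProbabilityMeasure_map (hX 0).aemeasurable
  -- `μ` is controlled only on the square, so a globally measurable modification replaces it; the
  -- covariates almost surely stay in the square.
  set g : Plane → ℝ := unitSquare.piecewise μ 0 with hg_def
  have hg : Measurable g := hμ.measurable_piecewise continuousOn_const measurableSet_Icc
  have hgμ : ∀ x ∈ unitSquare, g x = μ x := fun x hx => Set.piecewise_eq_of_mem _ _ _ hx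
  have hTm := measurable_scaledRowSum hε
  have hXT : ∀ m i, IndepFun (X i) (scaledRowSum ε m i) P := fun m i =>
    hXε.comp (φ := fun x : ℕ → Plane => x i)
      (ψ := fun e : ℕ × ℕ → ℝ => (Real.sqrt m)⁻¹ * ∑ k ∈ Finset.range m, e (i, k))
      (by fun_prop) (by fun_prop)
  have hpair : ∀ m, Pairwise fun i j => IndepFun (fun ω => (X i ω, scaledRowSum ε m i ω))
      (fun ω => (X j ω, scaledRowSum ε m j ω)) P := fun m i j hij =>
    indepFun_prodMk_of_indepFun (hX i) (hX j) (hTm m i) (hTm m j) (hX_indep.indepFun hij)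
      (indepFun_scaledRowSum hε hε_indep m hij)
      (hXε.comp (φ := fun x : ℕ → Plane => (x i, x j))
        (ψ := fun e : ℕ × ℕ → ℝ => ((Real.sqrt m)⁻¹ * ∑ k ∈ Finset.range m, e (i, k),
          (Real.sqrt m)⁻¹ * ∑ k ∈ Finset.range m, e (j, k))) (by fun_prop) (by fun_prop))
  have hlaw : ∀ m i, P.map (fun ω => (X i ω, scaledRowSum ε m i ω))
      = F.prod (scaledRowSumLaw P hε m : Measure ℝ) := fun m i => by
    rw [(indepFun_iff_map_prod_eq_prod_map_map (hX i).aemeasurable (hTm m i).aemeasurable).1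
      (hXT m i), hX_law i, map_scaledRowSum_eq hε hε_indep hε_ident m i]
    rfl
  have hφ := fun m => measurable_summand hg τ₀ γ hA m
  have hZm : ∀ m i, Measurable fun ω => (X i ω, scaledRowSum ε m i ω) := fun m i =>
    (hX i).prodMk (hTm m i)
  have key := tendsto_measure_average_sub (P := P)
    (Z := fun m i ω => summand g τ₀ γ A m (X i ω, scaledRowSum ε m i ω))
    (e := fun m => ∫ p, summand g τ₀ γ A m p ∂(F.prod (scaledRowSumLaw P hε m : Measure ℝ)))
    (e' := limitCriterion F γ S₀ A)
    (fun m i => ((hφ m).comp (hZm m i)).aemeasurable)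
    (fun m i ω => abs_summand_le_one hγ g τ₀ A m _)
    (fun m i j hij => (hpair m hij).comp (hφ m) (hφ m))
    (fun m i => by
      rw [← hlaw m i, integral_map (hZm m i).aemeasurable (hφ m).aestronglyMeasurable])
    (tendsto_integral_summand
      (tendsto_scaledRowSumLaw hε hε_indep hε_ident hε_var hε_mean) hg
      (fun x hx => (hgμ x (hS₀ hx)).trans (hμ_base x hx))
      (by
        filter_upwards [hF] with x hx hxS
        rw [hgμ x hx]
        exact hμ_pos x hx hxS) hγ hA) hδ
  have hsq : ∀ᵐ ω ∂P, ∀ i, X i ω ∈ unitSquare := by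
    refine ae_all_iff.2 fun i => ?_
    have h := hF
    rw [← hX_law i] at h
    exact ae_of_ae_map (hX i).aemeasurable h
  refine key.congr fun p => measure_congr ?_
  filter_upwards [hsq] with ω hω
  have hsum : ∀ i, (stdNormalCDF (Real.sqrt p.1 * (rowMean p.1 (fun j => Y i j ω) - τ₀)) - γ)
      * A.indicator 1 (X i ω) = summand g τ₀ γ A p.1 (X i ω, scaledRowSum ε p.1 i ω) := fun i => by
    rw [summand, sqrt_mul_rowMean_sub p.1 _ (fun j => ε i j ω) (μ (X i ω)) τ₀
      fun j => hY i j ω, hgμ _ (hω i)]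
    rfl
  change (δ ≤ _) = (δ ≤ _)
  simp only [empiricalCriterion, hsum]

end DoseResponse

/-! ### Uniform convergence over convex sets -/

namespace DoseResponse

/-- Uniform convergence over the closed convex sets follows from convergence on each measurable
set, by bracketing. -/
theorem tendsto_measure_exists_le_abs_sub {Ω ι : Type*} [MeasurableSpace Ω] {P : Measure Ω}
    {F : Measure Plane} [IsFiniteMeasure F] (hF : F ≪ volume) {τ₀ γ : ℝ}
    (hγ : γ ∈ Set.Icc (0 : ℝ) 1) {S₀ : Set Plane} (hS₀ : MeasurableSet S₀) {l : Filter ι}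
    {m n : ι → ℕ} {x : Ω → ℕ → Plane} {y : Ω → ℕ → ℕ → ℝ}
    (hM : ∀ A : Set Plane, MeasurableSet A → ∀ δ : ℝ, 0 < δ → Tendsto (fun p => P {ω | δ ≤
      |empiricalCriterion τ₀ γ (m p) (n p) (x ω) (y ω) A - limitCriterion F γ S₀ A|}) l (𝓝 0))
    (hN : ∀ A : Set Plane, MeasurableSet A → ∀ δ : ℝ, 0 < δ → Tendsto (fun p => P {ω | δ ≤
      |empiricalMass (n p) (x ω) A - F.real A|}) l (𝓝 0))
    {δ : ℝ} (hδ : 0 < δ) :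
    Tendsto (fun p => P {ω | ∃ S ∈ closedConvexSets, δ ≤
      |empiricalCriterion τ₀ γ (m p) (n p) (x ω) (y ω) S - limitCriterion F γ S₀ S|})
      l (𝓝 0) := by
  -- Off the exceptional events the error is below `δ/4 + δ/4 + 2 * (δ/8) < δ`.
  obtain ⟨B, hB, hBS⟩ := exists_finite_brackets hF
    (ENNReal.ofReal_pos.2 (show 0 < δ / 8 by positivity))
  have h4 : 0 < δ / 4 := by positivity
  have hlim := tendsto_finsetSum B fun b hb =>
    (hM b.1 (hB b hb).1 (δ / 4) h4).add
      (hN (b.2 \ b.1) ((hB b hb).2.1.diff (hB b hb).1) (δ / 4) h4)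
  simp only [add_zero, Finset.sum_const_zero] at hlim
  refine tendsto_of_tendsto_of_tendsto_of_le_of_le tendsto_const_nhds hlim
    (fun _ => zero_le) fun p => ?_
  refine (measure_mono (t := ⋃ b ∈ B,
    {ω | δ / 4 ≤ |empiricalCriterion τ₀ γ (m p) (n p) (x ω) (y ω) b.1
      - limitCriterion F γ S₀ b.1|} ∪
    {ω | δ / 4 ≤ |empiricalMass (n p) (x ω) (b.2 \ b.1) - F.real (b.2 \ b.1)|}) ?_).trans
    ((measure_biUnion_finset_le _ _).trans (Finset.sum_le_sum fun b _ => measure_union_le _ _))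
  rintro ω ⟨S, hS, hle⟩
  obtain ⟨b, hb, hbl, hbu⟩ := hBS S hS
  refine Set.mem_iUnion₂.2 ⟨b, hb, ?_⟩
  by_contra hcon
  have h1 : |empiricalCriterion τ₀ γ (m p) (n p) (x ω) (y ω) b.1
      - limitCriterion F γ S₀ b.1| < δ / 4 := not_le.1 fun h => hcon (Or.inl h)
  have h2 : |empiricalMass (n p) (x ω) (b.2 \ b.1) - F.real (b.2 \ b.1)| < δ / 4 :=
    not_le.1 fun h => hcon (Or.inr h)
  have h3 : F.real (b.2 \ b.1) < δ / 8 :=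
    (ENNReal.lt_ofReal_iff_toReal_lt (measure_ne_top _ _)).1 (hB b hb).2.2
  have h5 := abs_empiricalCriterion_sub_limitCriterion_le (F := F) τ₀ hγ (m p) (n p) (x ω) (y ω)
    hS₀ (hB b hb).1 hS.1.measurableSet hbl hbu
  linarith

end DoseResponse

/-! ### Consistency -/

theorem mainTheorem4
    {Ω : Type*} [MeasurableSpace Ω] (P : Measure Ω) [IsProbabilityMeasure P]
    -- the design distribution `F`, with Lebesgue density `f` on `[0,1]²`
    (F : Measure DoseResponse.Plane) (f : DoseResponse.Plane → ℝ≥0∞) (hf : Measurable f)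
    (hF : F = (volume.restrict DoseResponse.unitSquare).withDensity f)
    -- the regression function `μ`, with baseline value `τ₀` exactly on `S₀`
    (μ : DoseResponse.Plane → ℝ) (hμ : ContinuousOn μ DoseResponse.unitSquare)
    (τ₀ : ℝ) (S₀ : Set DoseResponse.Plane)
    (hμ_base : ∀ x ∈ S₀, μ x = τ₀)
    (hμ_pos : ∀ x ∈ DoseResponse.unitSquare, x ∉ S₀ → τ₀ < μ x)
    -- i.i.d. covariates with law `F`
    (X : ℕ → Ω → DoseResponse.Plane) (hX : ∀ i, Measurable (X i))
    (hX_law : ∀ i, P.map (X i) = F) (hX_indep : iIndepFun X P)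
    -- i.i.d. errors with mean zero and finite variance, independent of the covariates
    (ε : ℕ → ℕ → Ω → ℝ) (hε : ∀ i j, Measurable (ε i j))
    (hε_indep : iIndepFun (fun p : ℕ × ℕ => ε p.1 p.2) P)
    (hε_ident : ∀ i j, IdentDistrib (ε i j) (ε 0 0) P P)
    (hε_var : MemLp (ε 0 0) 2 P) (hε_mean : ∫ ω, ε 0 0 ω ∂P = 0)
    (hXε : IndepFun (fun ω (i : ℕ) => X i ω) (fun ω (p : ℕ × ℕ) => ε p.1 p.2 ω) P)
    -- the responses
    (Y : ℕ → ℕ → Ω → ℝ) (hY : ∀ i j ω, Y i j ω = μ (X i ω) + ε i j ω)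
    (γ : ℝ) (hγ : γ ∈ Set.Ioo (1 / 2 : ℝ) 1)
    (hS₀ : DoseResponse.IsUniqueMinimizer (DoseResponse.limitCriterion F γ S₀)
      DoseResponse.closedConvexSets S₀)
    -- the estimator: any (possibly nonmeasurable) choice of a minimizer
    (Shat : ℕ → ℕ → Ω → Set DoseResponse.Plane)
    (hShat : ∀ m n : ℕ, 0 < m → 0 < n → ∀ ω, DoseResponse.IsMinimizer
      (DoseResponse.empiricalCriterion τ₀ γ m n (fun i => X i ω) (fun i j => Y i j ω))
      DoseResponse.closedConvexSets (Shat m n ω)) :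
    DoseResponse.TendstoZeroInOuterProbability P
      (comap (fun p : ℕ × ℕ => min p.1 p.2) atTop)
      (fun p ω => ⨆ S ∈ DoseResponse.closedConvexSets, ENNReal.ofReal
        |DoseResponse.empiricalCriterion τ₀ γ p.1 p.2 (fun i => X i ω) (fun i j => Y i j ω) S
          - DoseResponse.limitCriterion F γ S₀ S|) ∧
    DoseResponse.TendstoZeroInOuterProbability P
      (comap (fun p : ℕ × ℕ => min p.1 p.2) atTop)
      (fun p ω => F (symmDiff (Shat p.1 p.2 ω) S₀)) ∧
    DoseResponse.TendstoZeroInOuterProbability P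
      (comap (fun p : ℕ × ℕ => min p.1 p.2) atTop)
      (fun p ω => Metric.hausdorffEDist (Shat p.1 p.2 ω) S₀) := by

  have hF_ac : F ≪ volume := by
    rw [hF]
    exact (withDensity_absolutelyContinuous _ _).trans Measure.absolutelyContinuous_restrict
  have hF_mem : ∀ᵐ x ∂F, x ∈ DoseResponse.unitSquare := by
    rw [hF]
    exact (withDensity_absolutelyContinuous _ _).ae_le (ae_restrict_mem measurableSet_Icc)
  have : IsProbabilityMeasure F := by
    rw [← hX_law 0]
    exact Measure.isProbabilityMeasure_map (hX 0).aemeasurable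
  have hγ' : γ ∈ Set.Icc (0 : ℝ) 1 := ⟨by linarith [hγ.1], hγ.2.le⟩
  have hunif : ∀ δ : ℝ, 0 < δ → Tendsto (fun p : ℕ × ℕ => P {ω |
      ∃ S ∈ DoseResponse.closedConvexSets, δ ≤
        |DoseResponse.empiricalCriterion τ₀ γ p.1 p.2 (fun i => X i ω) (fun i j => Y i j ω) S
          - DoseResponse.limitCriterion F γ S₀ S|})
      (comap (fun p : ℕ × ℕ => min p.1 p.2) atTop) (𝓝 0) := fun δ hδ =>
    DoseResponse.tendsto_measure_exists_le_abs_sub (x := fun ω i => X i ω)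
      (y := fun ω i j => Y i j ω) hF_ac hγ' hS₀.1.1.measurableSet
      (fun A hA δ hδ => DoseResponse.tendsto_measure_empiricalCriterion_sub hF_mem hμ hS₀.1.2.2
        hμ_base hμ_pos hX hX_law hX_indep hε hε_indep hε_ident hε_var hε_mean hXε hY hγ' hA hδ)
      (fun A hA δ hδ => DoseResponse.tendsto_measure_empiricalMass_sub hX hX_law hX_indep hA hδ) hδ
  -- The estimator is assumed to be a minimizer only for positive sample sizes.
  have hpos : ∀ᶠ p : ℕ × ℕ in comap (fun p : ℕ × ℕ => min p.1 p.2) atTop, 0 < p.1 ∧ 0 < p.2 :=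
    (tendsto_comap.eventually (eventually_gt_atTop 0)).mono fun p hp => lt_min_iff.1 hp
  have hhaus : ∀ δ : ℝ, 0 < δ → Tendsto (fun p : ℕ × ℕ => P {ω | ENNReal.ofReal δ ≤
      Metric.hausdorffEDist (Shat p.1 p.2 ω) S₀})
      (comap (fun p : ℕ × ℕ => min p.1 p.2) atTop) (𝓝 0) := fun δ hδ => by
    obtain ⟨η, hη, h⟩ :=
      DoseResponse.exists_hausdorffEDist_lt_of_limitCriterion_lt hF_ac hγ' hS₀ hδ
    refine tendsto_of_tendsto_of_tendsto_of_le_of_le' tendsto_const_nhds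
      (hunif (η / 2) (half_pos hη)) (Eventually.of_forall fun _ => zero_le) ?_
    filter_upwards [hpos] with p hp
    refine measure_mono fun ω hω => ?_
    by_contra hcon
    have hmin := hShat p.1 p.2 hp.1 hp.2 ω
    exact (h _ hmin.1 (DoseResponse.lt_add_of_isMinimizer hmin hS₀.1 fun T hT =>
      not_le.1 fun hle => hcon ⟨T, hT, hle⟩)).not_ge hω
  refine ⟨fun δ hδ => ?_, fun δ hδ => ?_, fun δ hδ => ?_⟩
  · refine tendsto_of_tendsto_of_tendsto_of_le_of_le tendsto_const_nhds
      (hunif δ hδ) (fun _ => zero_le) fun p => measure_mono fun ω hω => ?_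
    simp only [Set.mem_ofPred_eq, lt_iSup_iff] at hω
    obtain ⟨S, hS, hlt⟩ := hω
    rw [← ENNReal.ofReal_coe_nnreal] at hlt
    exact ⟨S, hS, ((ENNReal.ofReal_lt_ofReal_iff_of_nonneg δ.coe_nonneg).1 hlt).le⟩
  -- Consistency in `d_F` is deduced from Hausdorff consistency by continuity of the
  -- symmetric-difference mass at `S₀`.
  · obtain ⟨r, hr, h⟩ := DoseResponse.exists_measure_symmDiff_lt hF_ac hS₀.1
      (ENNReal.coe_pos.2 hδ)
    refine tendsto_of_tendsto_of_tendsto_of_le_of_le' tendsto_const_nhds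
      (hhaus r hr) (Eventually.of_forall fun _ => zero_le) ?_
    filter_upwards [hpos] with p hp
    refine measure_mono fun ω hω => ?_
    by_contra hcon
    have hlt : _ < ENNReal.ofReal r := not_le.1 fun hle => hcon hle
    exact (h _ (hShat p.1 p.2 hp.1 hp.2 ω).1 hlt).not_gt hω
  · refine tendsto_of_tendsto_of_tendsto_of_le_of_le tendsto_const_nhds
      (hhaus δ hδ) (fun _ => zero_le) fun p => measure_mono fun ω hω => ?_
    change ENNReal.ofReal δ ≤ _
    rw [ENNReal.ofReal_coe_nnreal]
    exact le_of_lt hω
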